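/- **Setting.** Let $S\subseteq\mathbb R^m$, $\mathfrak T\subseteq\mathbb R^l$, $\Theta\subseteq\mathbb R^p$ carry their Borel $\sigma$-fields, let $\rho$ be a $\sigma$-finite measure on $\mathfrak T$, $h:\Theta\times S\to\mathbb R^d$ a moment function and $k:\mathfrak T\times S\to G$ measurable in $x\in S$ for every $t$, where $G=\mathbb R$ (or $G=\mathbb C$ with the real inner product $\mathrm{Re}(\bar y z)$, or any finite-dimensional real inner product space). Put $\mathcal F=L^2(\mathfrak T,\rho;G)$ and let $n\ge 1$. For a $\sigma$-finite measure $\Pi$ on $S$ put $\mathcal E=L^2(S,\Pi)$ (real valued), and write $\mathcal{GP}(a,C)$ for the Gaussian measure with mean $a$ and covariance operator $C$ on a Hilbert space. A *model with dominating measure $\Pi$* consists of the following: * $h_i(\theta,\cdot)\in\mathcal E$ for all $\theta,i$; a true density $f_*\in\mathcal E$ (a probability density with respect to $\Pi$), with $dF_*=f_*\,d\Pi$ and $\int|k(t,x)|^2F_*(dx)<\infty$ for all $t$; * a bounded operator $K:\mathcal E\to\mathcal F$, $(Kf)(t)=\int k(t,x)f(x)\,\Pi(dx)$, and a bounded operator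 $\Sigma:\mathcal F\to\mathcal F$, $(\Sigma\psi)(t)=\int\sigma(t,s)\psi(s)\,\rho(ds)$, where $\sigma(t,s)=\mathrm{Cov}_{F_*}(k(t,X),k(s,X))$; * the sampling distribution $r_n\mid f\sim P^f=\mathcal{GP}(Kf,n^{-1}\Sigma)$ on $\mathcal F$, for every $f\in\mathcal E$; * for every $\theta\in\Theta$ a conditional prior $\mu(f\mid\theta)=\mathcal{GP}(f_{0\theta},\Omega_{0\theta})$ on $\mathcal E$, where $f_{0\theta}\in\mathcal E$ is a probability density with respect to $\Pi$ with $\int h(\theta,x)f_{0\theta}(x)\,\Pi(dx)=0$, and $\Omega_{0\theta}^{1/2}h_i(\theta,\cdot)=0$ for all $i$ and (when $1\in\mathcal E$) $\Omega_{0\theta}^{1/2}1=0$. Let $P_n^\theta=\int P^f\,\mu(df\mid\theta)$ be the marginal sampling distribution of $r_n$ given $\theta$, and $P_n^0=P^{f_*}=\mathcal{GP}(Kf_*,n^{-1}\Sigma)$. Let $\mu$ be a $\sigma$-finite (proper or improper) prior on $\Theta$. A version of the marginal posterior of $\theta$ is a map $r\mapsto\mu(\cdot\mid r)$ of the form $$\mu(d\theta\mid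 r)=\frac{p_{n\theta}(r)\,\mu(d\theta)}{\int_\Theta p_{n\theta}(r)\,\mu(d\theta)},$$ where $(\theta,r)\mapsto p_{n\theta}(r)$ is jointly measurable, $p_{n\theta}$ is a version of $dP_n^\theta/dP_n^0$ for every $\theta$, and the denominator is positive and finite for $P_n^0$-almost every $r$. **Statement.** Let $\Pi_1$ be a $\sigma$-finite measure on $S$, mutually absolutely continuous with $\Pi$, such that $d\Pi_1/d\Pi$ is ($\Pi$-essentially) bounded, and such that $\varphi(f)=f\,\frac{d\Pi}{d\Pi_1}$ defines a map $\varphi:L^2(S,\Pi)\to L^2(S,\Pi_1)$. Given a model with dominating measure $\Pi$, call a model with dominating measure $\Pi_1$ (and the same $n,\rho,h,k$) its *$\varphi$-transform* if its true density is $\varphi(f_*)$ and, for every $\theta$, its conditional prior is the law of $\varphi(f)$ when $f\sim\mu(f\mid\theta)$. Then a $\varphi$-transform exists, and for every $\varphi$-transform: 1. $P_n^0$ and, for every $\theta\in\Theta$, $P_n^\theta$ are the same in both models; 2. a map is a version of the marginal posterior $\mu(\theta\mid r_n)$ in one model if and only if it is one in the other; 3. any version of the posterior in the first model and any version in the second coincide,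 as measures on $\Theta$, for $P_n^0$-almost every $r$. So the marginal posterior of $\theta$ is unchanged under every such $\varphi$, and does not depend on the choice of the dominating measure. -/

import Mathlib

open MeasureTheory ProbabilityTheory
open scoped ENNReal NNReal

noncomputable section

namespace GPInvariance

/-- The Borel `σ`-field of an `L²` space (the one generated by its norm-open sets). -/
instance l2MeasurableSpace {X V : Type*} [MeasurableSpace X] [NormedAddCommGroup V]
    (m : Measure X) : MeasurableSpace (Lp V 2 m) := borel _

instance l2BorelSpace {X V : Type*} [MeasurableSpace X] [NormedAddCommGroup V]
    (m : Measure X) : BorelSpace (Lp V 2 m) := ⟨rfl⟩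

/-- `P = GP(m, C)`: the probability measure `P` on the Hilbert space `V` is Gaussian with mean `m`
and covariance operator `C`, i.e. `Cov_P(⟪u, ·⟫, ⟪v, ·⟫) = ⟪C u, v⟫`.
(Such a `C` is automatically self-adjoint, nonnegative and trace class.) -/
structure IsGP {V : Type*} [NormedAddCommGroup V] [InnerProductSpace ℝ V]
    [MeasurableSpace V] [BorelSpace V] (P : Measure V) (m : V) (C : V →L[ℝ] V) : Prop where
  gaussian : IsGaussian P
  mean : ∫ v, v ∂P = m
  covariance : ∀ u v : V, covarianceBilin P u v = inner ℝ (C u) v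

/-- `f` is (a version of) a probability density function with respect to `m`. -/
structure IsPdf {X : Type*} [MeasurableSpace X] (m : Measure X) (f : X → ℝ) : Prop where
  nonneg : ∀ᵐ x ∂m, 0 ≤ f x
  integrable : Integrable f m
  integral_eq_one : ∫ x, f x ∂m = 1

/-- The distribution `F` with `dF = f dm`. -/
def distr {X : Type*} [MeasurableSpace X] (m : Measure X) (f : X → ℝ) : Measure X :=
  m.withDensity fun x => ENNReal.ofReal (f x)

/-- The covariance `σ(t, s) = Cov_F(k(t, X), k(s, X))`, acting on `y`:
`E^F[⟪k(s, X), y⟫ k(t, X)] - ⟪E^F[k(s, X)], y⟫ E^F[k(t, X)]`. For real-valued `k` this is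
`(E^F[k(t, X) k(s, X)] - E^F[k(t, X)] E^F[k(s, X)]) * y`. -/
def kernelCov {S T G : Type*} [MeasurableSpace S] [NormedAddCommGroup G] [InnerProductSpace ℝ G]
    (F : Measure S) (k : T → S → G) (t s : T) (y : G) : G :=
  (∫ x, (inner ℝ (k s x) y : ℝ) • k t x ∂F) - (∫ x, (inner ℝ (k s x) y : ℝ) ∂F) • ∫ x, k t x ∂F

/-- For a positive operator `R`, a square root of `C`, the null spaces of `R` and `C` coincide:
the restriction `C^{1/2} u = 0` on a covariance operator is the same as `C u = 0`. -/
theorem sqrt_apply_eq_zero_iff {V : Type*} [NormedAddCommGroup V] [InnerProductSpace ℝ V]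
    {R C : V →L[ℝ] V} (hR : R.IsPositive) (hRC : R ∘L R = C) (u : V) : R u = 0 ↔ C u = 0 := by
  subst hRC
  constructor
  · intro h
    simp [h]
  · intro h
    have h1 : inner ℝ (R (R u)) u = inner ℝ (R u) (R u) := hR.isSymmetric (R u) u
    have h2 : R (R u) = 0 := h
    rw [h2, inner_zero_left] at h1
    exact inner_self_eq_zero.mp h1.symm

/-- The model, with the measure `Pi` on `S` as dominating measure. The nuisance parameter `f` lives
in `E = L²(S, Pi)`, the statistic `r_n` in `L²(T, rho)`; `h` is the moment function and `k` the
function that defines `r_n(t) = n⁻¹ ∑ k(t, X_i)`. `k` may be real valued (`G = ℝ`), complex valued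
(`G = ℂ`, viewed as a real inner product space), or have values in any `G`. -/
structure Model {S T Θ G : Type*} [MeasurableSpace S] [MeasurableSpace T]
    [NormedAddCommGroup G] [InnerProductSpace ℝ G] [CompleteSpace G] {d : ℕ}
    (n : ℕ) (rho : Measure T) (h : Θ → S → EuclideanSpace ℝ (Fin d)) (k : T → S → G)
    (Pi : Measure S) where
  /-- the moment functions are in `E` -/
  moment_memLp : ∀ θ i, MemLp (fun x => h θ x i) 2 Pi
  /-- the true density `f_*`, which is square integrable -/
  fstar : Lp ℝ 2 Pi
  fstar_pdf : IsPdf Pi fstar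
  /-- `k` is measurable in `x`, and `k(t, X)` has finite second moment under the true `F_*` -/
  k_meas : ∀ t, StronglyMeasurable (k t)
  k_memLp : ∀ t, MemLp (k t) 2 (distr Pi fstar)
  /-- the bounded operator `(K f)(t) = ∫ k(t, x) f(x) Pi(dx)` -/
  K : Lp ℝ 2 Pi →L[ℝ] Lp G 2 rho
  K_spec : ∀ f : Lp ℝ 2 Pi, ∀ᵐ t ∂rho,
    Integrable (fun x => f x • k t x) Pi ∧ K f t = ∫ x, f x • k t x ∂Pi
  /-- the covariance operator `(Σ ψ)(t) = ∫ σ(t, s) ψ(s) rho(ds)` -/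
  Sig : Lp G 2 rho →L[ℝ] Lp G 2 rho
  Sig_spec : ∀ ψ : Lp G 2 rho, ∀ᵐ t ∂rho,
    Integrable (fun s => kernelCov (distr Pi fstar) k t s (ψ s)) rho ∧
      Sig ψ t = ∫ s, kernelCov (distr Pi fstar) k t s (ψ s) ∂rho
  /-- the sampling distribution of `r_n` given `f`: `P^f = GP(K f, n⁻¹ Σ)` -/
  sampling : Lp ℝ 2 Pi → Measure (Lp G 2 rho)
  sampling_gp : ∀ f, IsGP (sampling f) (K f) ((n : ℝ)⁻¹ • Sig)
  /-- the prior mean `f_{0θ}`: a square integrable density satisfying the moment conditions -/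
  f0 : Θ → Lp ℝ 2 Pi
  f0_pdf : ∀ θ, IsPdf Pi (f0 θ)
  f0_moment : ∀ θ i, ∫ x, h θ x i * f0 θ x ∂Pi = 0
  /-- the prior covariance operator `Ω_{0θ}` -/
  Om : Θ → (Lp ℝ 2 Pi →L[ℝ] Lp ℝ 2 Pi)
  /-- `Ω_{0θ}^{1/2} h_i(θ, ·) = 0` and `Ω_{0θ}^{1/2} 1 = 0`
  (see `sqrt_apply_eq_zero_iff`; the second one presupposes that `1` is in `E`) -/
  Om_moment : ∀ θ i, ∀ u : Lp ℝ 2 Pi, (∀ᵐ x ∂Pi, u x = h θ x i) → Om θ u = 0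
  Om_one : ∀ θ, ∀ u : Lp ℝ 2 Pi, (∀ᵐ x ∂Pi, u x = 1) → Om θ u = 0
  /-- the conditional prior `μ(f | θ) = GP(f_{0θ}, Ω_{0θ})` -/
  prior : Θ → Measure (Lp ℝ 2 Pi)
  prior_gp : ∀ θ, IsGP (prior θ) (f0 θ) (Om θ)

namespace Model

variable {S T Θ G : Type*} [MeasurableSpace S] [MeasurableSpace T]
    [NormedAddCommGroup G] [InnerProductSpace ℝ G] [CompleteSpace G] {d : ℕ}
    {n : ℕ} {rho : Measure T} {h : Θ → S → EuclideanSpace ℝ (Fin d)} {k : T → S → G}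
    {Pi : Measure S}

/-- The marginal sampling distribution `P_n^θ` of `r_n` given `θ`: `f` is integrated out of `P^f`
with respect to the conditional prior. -/
def marginal (M : Model n rho h k Pi) (θ : Θ) : Measure (Lp G 2 rho) :=
  (M.prior θ).bind M.sampling

/-- The reference measure `P_n^0 = GP(K f_*, n⁻¹ Σ)`. -/
def reference (M : Model n rho h k Pi) : Measure (Lp G 2 rho) :=
  M.sampling M.fstar

/-- `p` is a (jointly measurable) version of the likelihood `p_{nθ} = dP_n^θ / dP_n^0`. -/
def IsLikelihood [MeasurableSpace Θ] (M : Model n rho h k Pi)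
    (p : Θ → Lp G 2 rho → ℝ≥0∞) : Prop :=
  Measurable (Function.uncurry p) ∧ ∀ θ, M.marginal θ = M.reference.withDensity (p θ)

/-- `post` is a version of the marginal posterior `μ(θ | r)`, for the (possibly improper) prior `μ`:
`μ(dθ | r) = p_{nθ}(r) μ(dθ) / ∫ p_{nθ}(r) μ(dθ)`, with a normalizing constant that is
almost surely positive and finite. -/
def IsPosterior [MeasurableSpace Θ] (M : Model n rho h k Pi) (μ : Measure Θ)
    (post : Lp G 2 rho → Measure Θ) : Prop :=
  ∃ p : Θ → Lp G 2 rho → ℝ≥0∞, M.IsLikelihood p ∧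
    (∀ᵐ r ∂M.reference, 0 < ∫⁻ θ, p θ r ∂μ ∧ ∫⁻ θ, p θ r ∂μ < ∞) ∧
    ∀ r, post r = (∫⁻ θ, p θ r ∂μ)⁻¹ • μ.withDensity fun θ => p θ r

end Model

/-- `φ` belongs to the set `Φ` of transformations: `φ` maps `L²(S, Pi)` to `L²(S, Pi₁)`,
`φ f = f * dPi/dPi₁`, and `dPi₁/dPi` is bounded. -/
structure IsChange {S : Type*} [MeasurableSpace S] (Pi Pi₁ : Measure S)
    (φ : Lp ℝ 2 Pi → Lp ℝ 2 Pi₁) : Prop where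
  ac : Pi ≪ Pi₁
  ac' : Pi₁ ≪ Pi
  apply_eq : ∀ f : Lp ℝ 2 Pi, ∀ᵐ x ∂Pi₁, φ f x = f x * (Pi.rnDeriv Pi₁ x).toReal
  bounded : ∃ c : ℝ≥0, ∀ᵐ x ∂Pi, Pi₁.rnDeriv Pi x ≤ c

/-- `M₁`, with dominating measure `Pi₁`, is the model `M` after the nuisance parameter has been
transformed by `φ`: the true density becomes `φ f_*` and the conditional prior becomes the law of
`φ f`, for `f` drawn from the conditional prior of `M`. (All the rest of `M₁` is determined
by `Pi₁`, as it is in any model.) -/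
structure IsTransform {S T Θ G : Type*} [MeasurableSpace S] [MeasurableSpace T]
    [NormedAddCommGroup G] [InnerProductSpace ℝ G] [CompleteSpace G] {d : ℕ}
    {n : ℕ} {rho : Measure T} {h : Θ → S → EuclideanSpace ℝ (Fin d)} {k : T → S → G}
    {Pi Pi₁ : Measure S} (φ : Lp ℝ 2 Pi → Lp ℝ 2 Pi₁)
    (M : Model n rho h k Pi) (M₁ : Model n rho h k Pi₁) : Prop where
  fstar_eq : M₁.fstar = φ M.fstar
  prior_eq : ∀ θ, M₁.prior θ = (M.prior θ).map φ

end GPInvariance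

end

noncomputable section

namespace GPInvariance

/-! ### Change of dominating measure as a linear homeomorphism of L² spaces. -/

section Transform

variable {S : Type*} [MeasurableSpace S] {Pi Pi₁ : Measure S}

/-! The signed measures `f dPi` and `φ f dPi₁` are the same, and the data see `f` only through this
measure. Hence `K (φ f)` and `Σ` do not change (`K_apply`, `Sig_eq`). A Gaussian law is determined
by its mean and covariance, so the sampling laws agree (`sampling_apply`). Integrating over the
image prior is then a change of variables (`marginal_eq`), and posteriors depend on the model only
through the reference and marginal laws.

For existence, `φ` must carry Gaussian priors to Gaussian priors. Its inverse, multiplication by the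
bounded `dPi₁/dPi`, is a continuous bijection, so `φ` is a linear homeomorphism
(`exists_continuousLinearEquiv`). The new covariance is `φ Ω φ*`. It keeps the null-space
constraints because `φ*` acts as the identity on functions (`adjoint_ae_eq`). -/

theorem memLp_mul_rnDeriv [SigmaFinite Pi] [SigmaFinite Pi₁] (hac : Pi ≪ Pi₁) (hac' : Pi₁ ≪ Pi)
    {c : ℝ≥0} (hc : ∀ᵐ x ∂Pi, Pi₁.rnDeriv Pi x ≤ c) (g : Lp ℝ 2 Pi₁) :
    MemLp (fun x => g x * (Pi₁.rnDeriv Pi x).toReal) 2 Pi ∧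
      ∫ x, (g x * (Pi₁.rnDeriv Pi x).toReal) ^ 2 ∂Pi ≤ c * ‖g‖ ^ 2 := by
  have hw : AEStronglyMeasurable (fun x => (Pi₁.rnDeriv Pi x).toReal) Pi :=
    (Measure.measurable_rnDeriv _ _).ennreal_toReal.aestronglyMeasurable
  have hwc : ∀ᵐ x ∂Pi, (Pi₁.rnDeriv Pi x).toReal ≤ c := by
    filter_upwards [hc] with x hx
    exact ENNReal.toReal_le_coe_of_le_coe hx
  have hg : AEStronglyMeasurable g Pi := (Lp.aestronglyMeasurable g).mono_ac hac
  have hsq : Integrable (fun x => g x ^ 2) Pi₁ :=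
    (memLp_two_iff_integrable_sq (Lp.aestronglyMeasurable g)).1 (Lp.memLp g)
  have h1 : Integrable (fun x => (Pi₁.rnDeriv Pi x).toReal * g x ^ 2) Pi :=
    (integrable_toReal_rnDeriv_mul_iff hac').2 hsq
  -- With `w = dPi₁/dPi`, one factor `w` is bounded by `c`; the other turns `g² w dPi` into `g²
  -- dPi₁`.
  have heq : ∀ x, (g x * (Pi₁.rnDeriv Pi x).toReal) ^ 2
      = (Pi₁.rnDeriv Pi x).toReal * ((Pi₁.rnDeriv Pi x).toReal * g x ^ 2) := fun x => by ring
  have h2 : Integrable (fun x => (g x * (Pi₁.rnDeriv Pi x).toReal) ^ 2) Pi := by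
    simp_rw [heq]
    refine h1.bdd_mul (c := c) hw ?_
    filter_upwards [hwc] with x hx
    rwa [Real.norm_of_nonneg ENNReal.toReal_nonneg]
  refine ⟨(memLp_two_iff_integrable_sq (hg.mul hw)).2 h2, ?_⟩
  calc ∫ x, (g x * (Pi₁.rnDeriv Pi x).toReal) ^ 2 ∂Pi
      ≤ ∫ x, c * ((Pi₁.rnDeriv Pi x).toReal * g x ^ 2) ∂Pi := by
        refine integral_mono_ae h2 (h1.const_mul _) ?_
        filter_upwards [hwc] with x hx
        rw [heq]
        exact mul_le_mul_of_nonneg_right hx (by positivity)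
    _ = c * ‖g‖ ^ 2 := by
        rw [integral_const_mul, integral_toReal_rnDeriv_mul hac', ← real_inner_self_eq_norm_sq,
          L2.inner_def]
        simp [pow_two]

/-- Multiplication by a bounded Radon-Nikodym derivative `dPi₁/dPi`, as a bounded linear map from
`L²(Pi₁)` to `L²(Pi)`. -/
def mulRnDeriv [SigmaFinite Pi] [SigmaFinite Pi₁] (hac : Pi ≪ Pi₁) (hac' : Pi₁ ≪ Pi)
    {c : ℝ≥0} (hc : ∀ᵐ x ∂Pi, Pi₁.rnDeriv Pi x ≤ c) : Lp ℝ 2 Pi₁ →L[ℝ] Lp ℝ 2 Pi :=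
  LinearMap.mkContinuous
    { toFun := fun g => (memLp_mul_rnDeriv hac hac' hc g).1.toLp _
      map_add' := fun f g => by
        rw [← MemLp.toLp_add]
        refine MemLp.toLp_congr _ _ ?_
        filter_upwards [hac.ae_le (Lp.coeFn_add f g)] with x hx
        simp only [_root_.Pi.add_apply, hx]
        ring
      map_smul' := fun a g => by
        rw [← MemLp.toLp_const_smul]
        refine MemLp.toLp_congr _ _ ?_
        filter_upwards [hac.ae_le (Lp.coeFn_smul a g)] with x hx
        simp only [_root_.Pi.smul_apply, hx, RingHom.id_apply, smul_eq_mul]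
        ring }
    (Real.sqrt c) fun g => by
      obtain ⟨h1, h2⟩ := memLp_mul_rnDeriv hac hac' hc g
      refine le_of_sq_le_sq ?_ (by positivity)
      rw [mul_pow, Real.sq_sqrt (NNReal.coe_nonneg c), ← real_inner_self_eq_norm_sq, L2.inner_def]
      refine le_of_eq_of_le (integral_congr_ae ?_) h2
      filter_upwards [h1.coeFn_toLp] with x hx
      simp only [LinearMap.coe_mk, AddHom.coe_mk, hx, real_inner_self_eq_norm_sq, Real.norm_eq_abs,
        sq_abs]

theorem coeFn_mulRnDeriv [SigmaFinite Pi] [SigmaFinite Pi₁] (hac : Pi ≪ Pi₁) (hac' : Pi₁ ≪ Pi)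
    {c : ℝ≥0} (hc : ∀ᵐ x ∂Pi, Pi₁.rnDeriv Pi x ≤ c) (g : Lp ℝ 2 Pi₁) :
    ∀ᵐ x ∂Pi, mulRnDeriv hac hac' hc g x = g x * (Pi₁.rnDeriv Pi x).toReal :=
  (memLp_mul_rnDeriv hac hac' hc g).1.coeFn_toLp

theorem rnDeriv_toReal_mul_rnDeriv_toReal [SigmaFinite Pi] [SigmaFinite Pi₁] (hac : Pi ≪ Pi₁) :
    ∀ᵐ x ∂Pi, (Pi.rnDeriv Pi₁ x).toReal * (Pi₁.rnDeriv Pi x).toReal = 1 := by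
  filter_upwards [Measure.inv_rnDeriv hac, Measure.rnDeriv_pos hac,
    hac.ae_le (Measure.rnDeriv_ne_top Pi Pi₁)] with x hx h0 ht
  rw [← hx, _root_.Pi.inv_apply, ← ENNReal.toReal_mul, ENNReal.mul_inv_cancel h0.ne' ht,
    ENNReal.toReal_one]

variable {φ : Lp ℝ 2 Pi → Lp ℝ 2 Pi₁}

namespace IsChange

/-- Every `φ ∈ Φ` is a linear homeomorphism. -/
theorem exists_continuousLinearEquiv [SigmaFinite Pi] [SigmaFinite Pi₁]
    (hφ : IsChange Pi Pi₁ φ) : ∃ e : Lp ℝ 2 Pi ≃L[ℝ] Lp ℝ 2 Pi₁, ∀ f, e f = φ f := by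
  obtain ⟨c, hc⟩ := hφ.bounded
  set ψ := mulRnDeriv hφ.ac hφ.ac' hc
  have h1 : ∀ f, ψ (φ f) = f := fun f => Lp.ext <| by
    filter_upwards [coeFn_mulRnDeriv hφ.ac hφ.ac' hc (φ f), hφ.ac.ae_le (hφ.apply_eq f),
      rnDeriv_toReal_mul_rnDeriv_toReal hφ.ac] with x h1 h2 h3
    rw [h1, h2, mul_assoc, h3, mul_one]
  have h2 : ∀ g, φ (ψ g) = g := fun g => Lp.ext <| by
    filter_upwards [hφ.ac'.ae_le (coeFn_mulRnDeriv hφ.ac hφ.ac' hc g), hφ.apply_eq (ψ g),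
      rnDeriv_toReal_mul_rnDeriv_toReal hφ.ac'] with x h1 h2 h3
    rw [h2, h1, mul_assoc, h3, mul_one]
  have hinj : Function.Injective ψ := Function.LeftInverse.injective h2
  have hsurj : Function.Surjective ψ := Function.RightInverse.surjective h1
  -- Open mapping theorem: `dPi/dPi₁` need not be bounded, so continuity of `φ` comes from inverting
  -- the continuous bijection `ψ`.
  refine ⟨(ContinuousLinearEquiv.ofBijective ψ (LinearMap.ker_eq_bot.2 hinj)
    (LinearMap.range_eq_top.2 hsurj)).symm, fun f => hinj ?_⟩
  rw [h1]
  exact ContinuousLinearEquiv.ofBijective_apply_symm_apply ψ _ _ f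

/-- The linear homeomorphism `L²(Pi) ≃ L²(Pi₁)` given by `φ`. -/
def equiv [SigmaFinite Pi] [SigmaFinite Pi₁] (hφ : IsChange Pi Pi₁ φ) :
    Lp ℝ 2 Pi ≃L[ℝ] Lp ℝ 2 Pi₁ :=
  hφ.exists_continuousLinearEquiv.choose

theorem equiv_apply [SigmaFinite Pi] [SigmaFinite Pi₁] (hφ : IsChange Pi Pi₁ φ)
    (f : Lp ℝ 2 Pi) : hφ.equiv f = φ f :=
  hφ.exists_continuousLinearEquiv.choose_spec f

theorem coe_equiv [SigmaFinite Pi] [SigmaFinite Pi₁] (hφ : IsChange Pi Pi₁ φ) :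
    ⇑hφ.equiv = φ :=
  funext hφ.equiv_apply

section Integral

variable {V : Type*} [NormedAddCommGroup V] [NormedSpace ℝ V]

theorem smul_ae_eq (hφ : IsChange Pi Pi₁ φ) (f : Lp ℝ 2 Pi) (g : S → V) :
    (fun x => φ f x • g x) =ᵐ[Pi₁] fun x => (Pi.rnDeriv Pi₁ x).toReal • (f x • g x) := by
  filter_upwards [hφ.apply_eq f] with x hx
  rw [hx, mul_comm, mul_smul]

theorem integrable_smul_iff [SigmaFinite Pi] [SigmaFinite Pi₁] (hφ : IsChange Pi Pi₁ φ)
    (f : Lp ℝ 2 Pi) (g : S → V) :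
    Integrable (fun x => φ f x • g x) Pi₁ ↔ Integrable (fun x => f x • g x) Pi := by
  rw [integrable_congr (hφ.smul_ae_eq f g), integrable_rnDeriv_smul_iff hφ.ac]

theorem integral_smul [SigmaFinite Pi] [SigmaFinite Pi₁] (hφ : IsChange Pi Pi₁ φ)
    (f : Lp ℝ 2 Pi) (g : S → V) :
    ∫ x, φ f x • g x ∂Pi₁ = ∫ x, f x • g x ∂Pi := by
  rw [integral_congr_ae (hφ.smul_ae_eq f g), integral_rnDeriv_smul hφ.ac]

end Integral

theorem isPdf [SigmaFinite Pi] [SigmaFinite Pi₁] (hφ : IsChange Pi Pi₁ φ)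
    {f : Lp ℝ 2 Pi} (hf : IsPdf Pi f) : IsPdf Pi₁ (φ f) where
  nonneg := by
    filter_upwards [hφ.apply_eq f, hφ.ac'.ae_le hf.nonneg] with x hx h0
    rw [hx]
    exact mul_nonneg h0 ENNReal.toReal_nonneg
  integrable := by
    have := hφ.integrable_smul_iff f fun _ => (1 : ℝ)
    simp only [smul_eq_mul, mul_one] at this
    exact this.2 hf.integrable
  integral_eq_one := by
    have := hφ.integral_smul f fun _ => (1 : ℝ)
    simp only [smul_eq_mul, mul_one] at this
    rw [this, hf.integral_eq_one]

/-- `φ` does not change the distribution of which `f` is the density. -/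
theorem distr_eq [SigmaFinite Pi] [SigmaFinite Pi₁] (hφ : IsChange Pi Pi₁ φ)
    (f : Lp ℝ 2 Pi) : distr Pi₁ (φ f) = distr Pi f := by
  have h1 : (fun x => ENNReal.ofReal (φ f x)) =ᵐ[Pi₁]
      Pi.rnDeriv Pi₁ * fun x => ENNReal.ofReal (f x) := by
    filter_upwards [hφ.apply_eq f, Measure.rnDeriv_ne_top Pi Pi₁] with x hx ht
    rw [hx, mul_comm, ENNReal.ofReal_mul ENNReal.toReal_nonneg, ENNReal.ofReal_toReal ht,
      _root_.Pi.mul_apply]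
  unfold distr
  rw [withDensity_congr_ae h1, withDensity_mul₀ (Measure.measurable_rnDeriv _ _).aemeasurable,
    Measure.withDensity_rnDeriv_eq _ _ hφ.ac]
  exact (Lp.stronglyMeasurable f).measurable.ennreal_ofReal.aemeasurable

/-- Keeps the moment functions square integrable under the new dominating measure. -/
theorem measure_le_smul [SigmaFinite Pi] [SigmaFinite Pi₁] (hφ : IsChange Pi Pi₁ φ) :
    ∃ c : ℝ≥0, Pi₁ ≤ (c : ℝ≥0∞) • Pi := by
  obtain ⟨c, hc⟩ := hφ.bounded
  refine ⟨c, ?_⟩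
  rw [← Measure.withDensity_rnDeriv_eq _ _ hφ.ac', ← withDensity_const]
  exact withDensity_mono hc

/-- The adjoint of `φ` leaves functions unchanged. -/
theorem adjoint_ae_eq [SigmaFinite Pi] [SigmaFinite Pi₁] (hφ : IsChange Pi Pi₁ φ)
    (u : Lp ℝ 2 Pi₁) :
    (ContinuousLinearMap.adjoint (hφ.equiv : Lp ℝ 2 Pi →L[ℝ] Lp ℝ 2 Pi₁) u : S → ℝ) =ᵐ[Pi] u := by
  set v := ContinuousLinearMap.adjoint (hφ.equiv : Lp ℝ 2 Pi →L[ℝ] Lp ℝ 2 Pi₁) u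
  have hind : ∀ s (hs : MeasurableSet s) (hμ : Pi s ≠ ∞),
      (fun x => indicatorConstLp 2 hs hμ (1 : ℝ) x • u x) =ᵐ[Pi] s.indicator u := by
    intro s hs hμ
    filter_upwards [indicatorConstLp_coeFn (p := 2) (hs := hs) (hμs := hμ) (c := (1 : ℝ))]
      with x hx
    rw [hx]
    by_cases hxs : x ∈ s <;> simp [hxs]
  -- Test on sets `s` of finite `Pi`-measure: `∫_s u dPi = ⟪φ 1_s, u⟫`, the inner product being in
  -- `L²(Pi₁)`. This also gives integrability of `u` on `s`, since `u` is not yet known to lie in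
  -- `L²(Pi)`.
  refine ae_eq_of_forall_setIntegral_eq_of_sigmaFinite (fun s _ hμ => ?_) (fun s hs hμ => ?_)
    fun s hs hμ => ?_
  · exact integrableOn_Lp_of_measure_ne_top v fact_one_le_two_ennreal.elim hμ.ne
  · rw [← integrable_indicator_iff hs, ← integrable_congr (hind s hs hμ.ne),
      ← hφ.integrable_smul_iff]
    simpa [mul_comm] using
      L2.integrable_inner (𝕜 := ℝ) (φ (indicatorConstLp 2 hs hμ.ne (1 : ℝ))) u
  · rw [← L2.inner_indicatorConstLp_one (𝕜 := ℝ) hs hμ.ne v,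
      ContinuousLinearMap.adjoint_inner_right, ← integral_indicator hs,
      ← integral_congr_ae (hind s hs hμ.ne), ← hφ.integral_smul, L2.inner_def]
    refine integral_congr_ae (ae_of_all _ fun x => ?_)
    simp [hφ.coe_equiv, mul_comm]

end IsChange

end Transform

/-! ### Gaussian measures on Hilbert spaces: uniqueness, linear images, translations. -/

section Gaussian

variable {V W : Type*} [NormedAddCommGroup V] [InnerProductSpace ℝ V] [CompleteSpace V]
  [SecondCountableTopology V] [MeasurableSpace V] [BorelSpace V]
  [NormedAddCommGroup W] [InnerProductSpace ℝ W] [CompleteSpace W]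
  [SecondCountableTopology W] [MeasurableSpace W] [BorelSpace W]

/-- A Gaussian measure is determined by its mean and its covariance operator. -/
theorem IsGP.unique {P Q : Measure V} {m : V} {C : V →L[ℝ] V} (hP : IsGP P m C)
    (hQ : IsGP Q m C) : P = Q := by
  have := hP.gaussian
  have := hQ.gaussian
  refine IsGaussian.ext (hP.mean.trans hQ.mean.symm) ?_
  ext u v
  rw [hP.covariance, hQ.covariance]

/-- The image of `GP(m, C)` under a bounded linear map `L` is `GP(L m, L C L*)`. -/
theorem IsGP.map {P : Measure V} {m : V} {C : V →L[ℝ] V} (hP : IsGP P m C) (L : V →L[ℝ] W) :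
    IsGP (P.map L) (L m) (L ∘L C ∘L ContinuousLinearMap.adjoint L) where
  gaussian := by
    have := hP.gaussian
    infer_instance
  mean := by
    have := hP.gaussian
    rw [integral_map (f := fun w => w) L.continuous.aemeasurable aestronglyMeasurable_id,
      L.integral_comp_comm (φ := fun v => v) (memLp_one_iff_integrable.1 (IsGaussian.memLp_id P 1 (by simp))),
      ← hP.mean]
  covariance u v := by
    have := hP.gaussian
    rw [covarianceBilin_map IsGaussian.memLp_two_id, hP.covariance,
      ContinuousLinearMap.adjoint_inner_right]
    rfl

/-- Translation of a Gaussian measure. -/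
theorem IsGP.map_const_add {P : Measure V} {C : V →L[ℝ] V} (hP : IsGP P 0 C) (m : V) :
    IsGP (P.map (m + ·)) m C where
  gaussian := by
    have := hP.gaussian
    infer_instance
  mean := by
    have := hP.gaussian
    rw [integral_map (by fun_prop) (by fun_prop), integral_add (g := fun v => v) (integrable_const _)
      (memLp_one_iff_integrable.1 (IsGaussian.memLp_id P 1 (by simp)))]
    simp [hP.mean]
  covariance u v := by
    have := hP.gaussian
    rw [covarianceBilin_map_const_add, hP.covariance]

end Gaussian

/-! ### Measurability of the sampling kernel and existence of the transformed model. -/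

namespace Model

variable {S T Θ G : Type*} [MeasurableSpace S] [MeasurableSpace T]
    [NormedAddCommGroup G] [InnerProductSpace ℝ G] [CompleteSpace G] {d : ℕ}
    {n : ℕ} {rho : Measure T} {h : Θ → S → EuclideanSpace ℝ (Fin d)} {k : T → S → G}
    {Pi Pi₁ : Measure S} {φ : Lp ℝ 2 Pi → Lp ℝ 2 Pi₁}

/-- The sampling distributions `P^f` form a Markov kernel. -/
theorem measurable_sampling [SecondCountableTopology (Lp G 2 rho)] (M : Model n rho h k Pi) :
    Measurable M.sampling := by
  have h0 : IsGP (M.sampling 0) 0 ((n : ℝ)⁻¹ • M.Sig) := by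
    simpa using M.sampling_gp 0
  have := h0.gaussian
  -- The covariance does not depend on `f`, so each `P^f` is a translate of `P^0`, and `P^f(s)` is
  -- the measure of a section of a measurable set.
  have heq : ∀ f, M.sampling f = (M.sampling 0).map (M.K f + ·) := fun f =>
    (M.sampling_gp f).unique (h0.map_const_add _)
  refine Measure.measurable_of_measurable_coe _ fun s hs => ?_
  have hm : Measurable fun q : Lp ℝ 2 Pi × Lp G 2 rho => M.K q.1 + q.2 :=
    (M.K.continuous.measurable.comp measurable_fst).add measurable_snd
  have := measurable_measure_prodMk_left (ν := M.sampling 0) (hm hs)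
  convert this using 2 with f
  rw [heq f, Measure.map_apply (by fun_prop) hs]
  rfl

variable [SigmaFinite Pi] [SigmaFinite Pi₁] [SecondCountableTopology (Lp ℝ 2 Pi)]
  [SecondCountableTopology (Lp ℝ 2 Pi₁)]

/-- The model obtained from `M` by transforming the nuisance parameter with `φ`. -/
def transform (M : Model n rho h k Pi) (hφ : IsChange Pi Pi₁ φ) : Model n rho h k Pi₁ where
  moment_memLp θ i := by
    obtain ⟨c, hc⟩ := hφ.measure_le_smul
    exact (M.moment_memLp θ i).of_measure_le_smul ENNReal.coe_ne_top hc
  fstar := φ M.fstar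
  fstar_pdf := hφ.isPdf M.fstar_pdf
  k_meas := M.k_meas
  k_memLp t := by
    rw [hφ.distr_eq]
    exact M.k_memLp t
  K := M.K ∘L (hφ.equiv.symm : Lp ℝ 2 Pi₁ →L[ℝ] Lp ℝ 2 Pi)
  K_spec f := by
    have hf : φ (hφ.equiv.symm f) = f := by
      rw [← hφ.equiv_apply, ContinuousLinearEquiv.apply_symm_apply]
    filter_upwards [M.K_spec (hφ.equiv.symm f)] with t ht
    rw [← hφ.integrable_smul_iff, ← hφ.integral_smul, hf] at ht
    exact ht
  Sig := M.Sig
  Sig_spec := by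
    rw [hφ.distr_eq]
    exact M.Sig_spec
  sampling f := M.sampling (hφ.equiv.symm f)
  sampling_gp f := M.sampling_gp (hφ.equiv.symm f)
  f0 θ := φ (M.f0 θ)
  f0_pdf θ := hφ.isPdf (M.f0_pdf θ)
  f0_moment θ i := by
    have h1 := hφ.integral_smul (M.f0 θ) fun x => h θ x i
    simp only [smul_eq_mul, mul_comm _ (h θ _ i)] at h1
    rw [h1, M.f0_moment]
  Om θ := (hφ.equiv : Lp ℝ 2 Pi →L[ℝ] Lp ℝ 2 Pi₁) ∘L M.Om θ ∘L
    ContinuousLinearMap.adjoint (hφ.equiv : Lp ℝ 2 Pi →L[ℝ] Lp ℝ 2 Pi₁)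
  Om_moment θ i u hu := by
    -- `φ* u` is again a version of the moment function, so the old covariance already annihilates
    -- it.
    have := M.Om_moment θ i
      (ContinuousLinearMap.adjoint (hφ.equiv : Lp ℝ 2 Pi →L[ℝ] Lp ℝ 2 Pi₁) u)
      ((hφ.adjoint_ae_eq u).trans (hφ.ac.ae_le hu))
    simp [this]
  Om_one θ u hu := by
    have := M.Om_one θ
      (ContinuousLinearMap.adjoint (hφ.equiv : Lp ℝ 2 Pi →L[ℝ] Lp ℝ 2 Pi₁) u)
      ((hφ.adjoint_ae_eq u).trans (hφ.ac.ae_le hu))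
    simp [this]
  prior θ := (M.prior θ).map φ
  prior_gp θ := by
    have := (M.prior_gp θ).map (hφ.equiv : Lp ℝ 2 Pi →L[ℝ] Lp ℝ 2 Pi₁)
    simpa only [ContinuousLinearEquiv.coe_coe, hφ.coe_equiv] using this

theorem isTransform_transform (M : Model n rho h k Pi) (hφ : IsChange Pi Pi₁ φ) :
    IsTransform φ M (M.transform hφ) :=
  ⟨rfl, fun _ => rfl⟩

end Model

/-! ### Invariance of the sampling laws and of the posterior. -/

namespace IsTransform

variable {S T Θ G : Type*} [MeasurableSpace S] [MeasurableSpace T]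
    [NormedAddCommGroup G] [InnerProductSpace ℝ G] [CompleteSpace G] {d : ℕ}
    {n : ℕ} {rho : Measure T} {h : Θ → S → EuclideanSpace ℝ (Fin d)} {k : T → S → G}
    {Pi Pi₁ : Measure S} {φ : Lp ℝ 2 Pi → Lp ℝ 2 Pi₁} [SigmaFinite Pi] [SigmaFinite Pi₁]
    {M : Model n rho h k Pi} {M₁ : Model n rho h k Pi₁}

theorem K_apply (hφ : IsChange Pi Pi₁ φ) (f : Lp ℝ 2 Pi) : M₁.K (φ f) = M.K f :=
  Lp.ext <| by
    filter_upwards [M.K_spec f, M₁.K_spec (φ f)] with t h1 h2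
    rw [h1.2, h2.2, hφ.integral_smul]

/-- The kernel of `Σ` involves the true density only through the distribution `F_*`. -/
theorem Sig_eq (hφ : IsChange Pi Pi₁ φ) (hM : IsTransform φ M M₁) : M₁.Sig = M.Sig :=
  ContinuousLinearMap.ext fun ψ => Lp.ext <| by
    filter_upwards [M.Sig_spec ψ, M₁.Sig_spec ψ] with t h1 h2
    rw [h1.2, h2.2, hM.fstar_eq, hφ.distr_eq]

variable [SecondCountableTopology (Lp G 2 rho)]

theorem sampling_apply (hφ : IsChange Pi Pi₁ φ) (hM : IsTransform φ M M₁) (f : Lp ℝ 2 Pi) :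
    M₁.sampling (φ f) = M.sampling f := by
  have h1 := M₁.sampling_gp (φ f)
  rw [K_apply (M := M) hφ, hM.Sig_eq hφ] at h1
  exact h1.unique (M.sampling_gp f)

theorem reference_eq (hφ : IsChange Pi Pi₁ φ) (hM : IsTransform φ M M₁) :
    M₁.reference = M.reference := by
  rw [Model.reference, hM.fstar_eq, hM.sampling_apply hφ, Model.reference]

theorem marginal_eq (hφ : IsChange Pi Pi₁ φ) (hM : IsTransform φ M M₁) (θ : Θ) :
    M₁.marginal θ = M.marginal θ := by
  have hm : Measurable φ := by
    rw [← hφ.coe_equiv]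
    exact hφ.equiv.continuous.measurable
  rw [Model.marginal, Model.marginal, hM.prior_eq, Measure.bind, Measure.bind,
    Measure.map_map M₁.measurable_sampling hm]
  exact congrArg (fun κ => ((M.prior θ).map κ).join) (funext fun f => hM.sampling_apply hφ f)

theorem isPosterior_iff [MeasurableSpace Θ] (hφ : IsChange Pi Pi₁ φ) (hM : IsTransform φ M M₁)
    (μ : Measure Θ) (post : Lp G 2 rho → Measure Θ) :
    M₁.IsPosterior μ post ↔ M.IsPosterior μ post := by
  simp only [Model.IsPosterior, Model.IsLikelihood, hM.reference_eq hφ, hM.marginal_eq hφ]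

end IsTransform

/-- Two versions of the marginal posterior coincide almost surely. -/
theorem Model.IsPosterior.ae_eq {S T Θ G : Type*} [MeasurableSpace S] [MeasurableSpace T]
    [NormedAddCommGroup G] [InnerProductSpace ℝ G] [CompleteSpace G] {d : ℕ}
    {n : ℕ} {rho : Measure T} {h : Θ → S → EuclideanSpace ℝ (Fin d)} {k : T → S → G}
    {Pi : Measure S} [MeasurableSpace Θ] {M : Model n rho h k Pi} {μ : Measure Θ} [SFinite μ]
    {post post' : Lp G 2 rho → Measure Θ} (hp : M.IsPosterior μ post)
    (hp' : M.IsPosterior μ post') : ∀ᵐ r ∂M.reference, post r = post' r := by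
  obtain ⟨p, ⟨hpm, hpd⟩, -, hpost⟩ := hp
  obtain ⟨p', ⟨hpm', hpd'⟩, -, hpost'⟩ := hp'
  have : IsGaussian M.reference := (M.sampling_gp M.fstar).gaussian
  have h1 : ∀ᵐ θ ∂μ, ∀ᵐ r ∂M.reference, p θ r = p' θ r := ae_of_all _ fun θ =>
    (withDensity_eq_iff_of_sigmaFinite (hpm.comp measurable_prodMk_left).aemeasurable
      (hpm'.comp measurable_prodMk_left).aemeasurable).1 ((hpd θ).symm.trans (hpd' θ))
  -- The exceptional null set of `r` depends on `θ`; joint measurability and Fubini exchange the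
  -- quantifiers, so for almost every `r` the likelihoods agree for `μ`-almost every `θ`.
  filter_upwards [(Measure.ae_ae_comm (p := fun θ r => p θ r = p' θ r)
    (measurableSet_eq_fun hpm hpm')).1 h1] with r hr
  rw [hpost, hpost', lintegral_congr_ae hr, withDensity_congr_ae hr]

end GPInvariance

end

theorem mainTheorem7 {m l p d n : ℕ} (hn : 0 < n)
    {S : Set (EuclideanSpace ℝ (Fin m))} {T : Set (EuclideanSpace ℝ (Fin l))}
    {Θ : Set (EuclideanSpace ℝ (Fin p))}
    {G : Type*} [NormedAddCommGroup G] [InnerProductSpace ℝ G] [FiniteDimensional ℝ G]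
    [CompleteSpace G]
    (rho : Measure T) [SigmaFinite rho]
    (h : Θ → S → EuclideanSpace ℝ (Fin d)) (k : T → S → G)
    (μ : Measure Θ) [SigmaFinite μ]
    (Pi Pi₁ : Measure S) [SigmaFinite Pi] [SigmaFinite Pi₁]
    (φ : Lp ℝ 2 Pi → Lp ℝ 2 Pi₁) (hφ : GPInvariance.IsChange Pi Pi₁ φ)
    (M : GPInvariance.Model n rho h k Pi) :
    (∃ M₁ : GPInvariance.Model n rho h k Pi₁, GPInvariance.IsTransform φ M M₁) ∧
    ∀ M₁ : GPInvariance.Model n rho h k Pi₁, GPInvariance.IsTransform φ M M₁ →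
      (M₁.reference = M.reference ∧ ∀ θ, M₁.marginal θ = M.marginal θ) ∧
      (∀ post, M₁.IsPosterior μ post ↔ M.IsPosterior μ post) ∧
      (∀ post post₁, M.IsPosterior μ post → M₁.IsPosterior μ post₁ →
        ∀ᵐ r ∂M.reference, post r = post₁ r) := by
  -- This and properness of `G` let instance search find second countability of the L² spaces.
  have : Fact ((2 : ℝ≥0∞) ≠ ∞) := ⟨ENNReal.ofNat_ne_top⟩
  have : ProperSpace G := FiniteDimensional.proper_real G
  refine ⟨⟨M.transform hφ, M.isTransform_transform hφ⟩, fun M₁ hM => ⟨⟨hM.reference_eq hφ,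
    hM.marginal_eq hφ⟩, fun post => hM.isPosterior_iff hφ μ post, fun post post₁ hp hp₁ => ?_⟩⟩
  exact hp.ae_eq ((hM.isPosterior_iff hφ μ post₁).1 hp₁)
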